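/- Let $\mathbb{K}$ be a field, $\Gamma$ a divisible totally ordered abelian group, and $\nu_0:\mathbb{K}\to\Gamma\cup\{\infty\}$ a valuation. Consider the valuations $\mu:\mathbb{K}[x]\to\Gamma\cup\{\infty\}$ with $\mu|_{\mathbb{K}}=\nu_0$, ordered by $\mu\le\eta$ iff $\mu(f)\le\eta(f)$ for all $f\in\mathbb{K}[x]$; such a $\mu$ may take the value $\infty$ at nonzero polynomials, and it is called Krull if it does not. We say that $\mu$ is *value-transcendental* if it is not Krull or the quotient $\mu(\mathbb{K}[x])/\nu_0\mathbb{K}$ of value groups is not a torsion group; *residue-transcendental* if it is Krull and, for its extension to $\mathbb{K}(x)$, the residue field extension $\mathbb{K}(x)\mu\mid\mathbb{K}\nu_0$ is transcendental; *valuation-algebraic* if it is neither. Let $\nu$ be such a valuation on $\mathbb{K}[x]$. Choose an extension $\overline{\nu}$ of $\nu$ to $\overline{\mathbb{K}}[x]$ with values in $\Gamma\cup\{\infty\}$, where $\overline{\mathbb{K}}$ is an algebraic closure of $\mathbb{K}$. For a nonzero $f\in\mathbb{K}[x]$ put $\delta(f)=\max\{\overline{\nu}(x-a)\mid a\in\overline{\mathbb{K}},\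 f(a)=0\}$ if $\deg f>0$ and $\delta(f)=-\infty$ if $\deg f=0$ (this does not depend on the choice of $\overline{\nu}$). A non-constant monic polynomial $Q\in\mathbb{K}[x]$ is a *key polynomial* for $\nu$ if $\deg f\ge\deg Q$ for every nonzero $f\in\mathbb{K}[x]$ with $\delta(f)\ge\delta(Q)$. The *truncation* of $\nu$ at a non-constant $Q$ is the map $\nu_Q(f)=\min_{0\le i\le s}\nu(f_iQ^i)$, where $f=f_0+f_1Q+\dots+f_sQ^s$ with $\deg f_i<\deg Q$ for all $i$. Suppose that $\nu$ is valuation-algebraic. Then there is a set $\mathbf{Q}$ of key polynomials for $\nu$ such that each truncation $\nu_Q$, $Q\in\mathbf{Q}$, is a valuation on $\mathbb{K}[x]$ extending $\nu_0$, and the set $\mathfrak{v}=\{\nu_Q\}_{Q\in\mathbf{Q}}$ has the following properties: 1. $\mathfrak{v}$ is totally ordered and has no maximal element; 2. every $f\in\mathbb{K}[x]$ is $\mathfrak{v}$-stable, that is, there is $Q_f\in\mathbf{Q}$ such that $\nu_Q(f)=\nu_{Q_f}(f)$ for every $Q\in\mathbf{Q}$ with $\nu_Q\ge\nu_{Q_f}$;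 3. $\nu=\sup_{Q\in\mathbf{Q}}\nu_Q$, that is, $\nu(f)=\nu_{Q_f}(f)$ for every $f\in\mathbb{K}[x]$ and every $Q_f$ as in 2; in particular $\nu$ is the least upper bound of $\mathfrak{v}$ among the valuations on $\mathbb{K}[x]$ extending $\nu_0$ with values in $\Gamma\cup\{\infty\}$; 4. each $\nu_Q$, $Q\in\mathbf{Q}$, is residue-transcendental. -/

import Mathlib

open Polynomial

noncomputable section

namespace KeyPoly

/-- A valuation on a commutative ring is *Krull* if its support is `{0}`. -/
def IsKrull {R Γ : Type*} [CommRing R] [AddCommGroup Γ] [LinearOrder Γ] [IsOrderedAddMonoid Γ]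
    (ν : AddValuation R (WithTop Γ)) : Prop :=
  ∀ f : R, ν f = ⊤ → f = 0

/-- The value group of a valuation: the subgroup of `Γ` generated by the finite values. -/
def valueGroup {R Γ : Type*} [CommRing R] [AddCommGroup Γ] [LinearOrder Γ] [IsOrderedAddMonoid Γ]
    (ν : AddValuation R (WithTop Γ)) : AddSubgroup Γ :=
  AddSubgroup.closure {γ : Γ | ∃ f : R, ν f = (γ : WithTop Γ)}

variable {K Γ : Type*} [Field K] [AddCommGroup Γ] [LinearOrder Γ] [IsOrderedAddMonoid Γ]

/-- The valuations on `K[x]` with values in `Γ ∪ {∞}` that extend the valuation `ν₀` of `K`. -/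
def ExtVal (ν₀ : AddValuation K (WithTop Γ)) : Type _ :=
  {ν : AddValuation K[X] (WithTop Γ) // ∀ a : K, ν (C a) = ν₀ a}

/-- `μ ≤ η` if and only if `μ f ≤ η f` for every polynomial `f`. -/
instance (ν₀ : AddValuation K (WithTop Γ)) : PartialOrder (ExtVal ν₀) :=
  PartialOrder.lift (fun (ν : ExtVal ν₀) (f : K[X]) => ν.1 f)
    (fun _ _ h => Subtype.ext (DFunLike.coe_injective h))

/-! ### Key polynomials and truncations -/

/-- `δ(f) = max {ν̄(x - a) | f(a) = 0}` for a nonzero polynomial `f` over the algebraic closure;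
it is `⊥ = -∞` if `f` is a nonzero constant. -/
def delta (νbar : AddValuation (AlgebraicClosure K)[X] (WithTop Γ))
    (f : (AlgebraicClosure K)[X]) : WithBot (WithTop Γ) :=
  open Classical in
  f.roots.toFinset.sup (fun a => ((νbar (X - C a) : WithTop Γ) : WithBot (WithTop Γ)))

/-- `ν̄` is an extension of `ν` from `K[x]` to polynomials over the algebraic closure. -/
def ExtendsToClosure (νbar : AddValuation (AlgebraicClosure K)[X] (WithTop Γ))
    (ν : AddValuation K[X] (WithTop Γ)) : Prop :=
  ∀ f : K[X], νbar (f.map (algebraMap K (AlgebraicClosure K))) = ν f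

/-- `Q` is a key polynomial for `ν`: it is monic, not constant, and every nonzero polynomial `f`
over `K` with `δ(f) ≥ δ(Q)` has `deg f ≥ deg Q`. Here `δ` is computed with an extension `ν̄` of `ν`
to the polynomials over the algebraic closure; the values `δ(f)`, for `f` over `K`, do not depend
on the extension. -/
def IsKeyPolynomial (ν : AddValuation K[X] (WithTop Γ)) (Q : K[X]) : Prop :=
  Q.Monic ∧ 0 < Q.natDegree ∧
    ∃ νbar : AddValuation (AlgebraicClosure K)[X] (WithTop Γ), ExtendsToClosure νbar ν ∧
      ∀ f : K[X], f ≠ 0 →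
        delta νbar (Q.map (algebraMap K (AlgebraicClosure K))) ≤
          delta νbar (f.map (algebraMap K (AlgebraicClosure K))) →
        Q.natDegree ≤ f.natDegree

/-- The `i`-th coefficient of the `q`-expansion `f = f₀ + f₁ q + ⋯ + fₛ qˢ` (with
`deg fᵢ < deg q`), for a non-constant `q`: divide `i` times by `q`, then take the remainder. -/
def expansionCoeff (q f : K[X]) (i : ℕ) : K[X] :=
  ((fun g : K[X] => g / q)^[i] f) % q

/-- The truncation `ν_q(f) = min ν(fᵢ qⁱ)` of `ν` at a non-constant `q`. The coefficients `fᵢ` with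
`i > deg f` vanish, and vanishing coefficients contribute the value `∞`. -/
def truncation (ν : AddValuation K[X] (WithTop Γ)) (q f : K[X]) : WithTop Γ :=
  (Finset.range (f.natDegree + 1)).inf (fun i => ν (expansionCoeff q f i * q ^ i))

/-! ### Valuation-algebraic and residue-transcendental valuations -/

theorem IsKrull.le_primeCompl {ν : AddValuation K[X] (WithTop Γ)} (h : IsKrull ν) :
    nonZeroDivisors K[X] ≤ (AddValuation.toValuation ν).supp.primeCompl := by
  intro f hf hsupp
  exact nonZeroDivisors.ne_zero hf (h f hsupp)

/-- The unique extension of a Krull valuation on `K[x]` to the field `K(x)`, written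
multiplicatively. -/
def fracValuation (ν : AddValuation K[X] (WithTop Γ)) (h : IsKrull ν) :
    Valuation (RatFunc K) (Multiplicative (WithTop Γ)ᵒᵈ) :=
  (AddValuation.toValuation ν).extendToLocalization h.le_primeCompl (RatFunc K)

theorem fracValuation_hasExtension {ν₀ : AddValuation K (WithTop Γ)} (ν : ExtVal ν₀)
    (h : IsKrull ν.1) :
    (AddValuation.toValuation ν₀).HasExtension (fracValuation ν.1 h) := by
  constructor
  have : AddValuation.toValuation ν₀ =
      (fracValuation ν.1 h).comap (algebraMap K (RatFunc K)) := by
    ext a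
    rw [Valuation.comap_apply, IsScalarTower.algebraMap_apply K K[X] (RatFunc K), fracValuation,
      Valuation.extendToLocalization_apply_map_apply]
    exact (ν.2 a).symm
  rw [← this]
  exact Valuation.IsEquiv.refl

/-- `ν` is residue-transcendental: it is Krull and the extension of residue fields
`K(x)ν | Kν₀` is transcendental. -/
def IsResidueTranscendental {ν₀ : AddValuation K (WithTop Γ)} (ν : ExtVal ν₀) : Prop :=
  ∃ h : IsKrull ν.1,
    letI := fracValuation_hasExtension ν h
    Algebra.Transcendental
      (IsLocalRing.ResidueField (AddValuation.toValuation ν₀).valuationSubring)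
      (IsLocalRing.ResidueField (fracValuation ν.1 h).valuationSubring)

/-- `ν` is value-transcendental: it is not Krull or the quotient of its value group by that of
`ν₀` is not a torsion group. -/
def IsValueTranscendental {ν₀ : AddValuation K (WithTop Γ)} (ν : ExtVal ν₀) : Prop :=
  ¬ IsKrull ν.1 ∨
    ¬ IsAddTorsion
      (valueGroup ν.1 ⧸ (valueGroup ν₀).addSubgroupOf (valueGroup ν.1))

/-- `ν` is valuation-algebraic: it is neither value-transcendental nor residue-transcendental. -/
def IsValuationAlgebraic {ν₀ : AddValuation K (WithTop Γ)} (ν : ExtVal ν₀) : Prop :=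
  ¬ (IsValueTranscendental ν ∨ IsResidueTranscendental ν)

/-! ### Stability and suprema of totally ordered sets of valuations -/

/-- From the element `μ` of `S` on, all members of `S` take the same value at `f`. -/
def StableFrom {ν₀ : AddValuation K (WithTop Γ)} (S : Set (ExtVal ν₀)) (f : K[X])
    (μ : ExtVal ν₀) : Prop :=
  μ ∈ S ∧ ∀ η ∈ S, μ ≤ η → η.1 f = μ.1 f

/-- `f` is `S`-stable. -/
def IsStable {ν₀ : AddValuation K (WithTop Γ)} (S : Set (ExtVal ν₀)) (f : K[X]) : Prop :=
  ∃ μ : ExtVal ν₀, StableFrom S f μ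

/-- `ν` is the supremum of a totally ordered set `S` for which all polynomials are stable: `ν f`
is the stable value of `f`, for every `f`. -/
def IsStableSup {ν₀ : AddValuation K (WithTop Γ)} (S : Set (ExtVal ν₀)) (ν : ExtVal ν₀) : Prop :=
  ∀ f : K[X], ∀ μ : ExtVal ν₀, StableFrom S f μ → ν.1 f = μ.1 f

end KeyPoly

end

open KeyPoly

/-!
Extend `ν` to a valuation `νbar` of polynomials over the algebraic closure. For a centre `a`, the
Gauss valuation at `a` that gives `x - a` the value `νbar (x - a)` is at most `νbar`, increases with
`νbar (x - a)`, and agrees with `νbar` at every `f` with `δ(f) ≤ νbar (x - a)`, because `f` is a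
product of linear factors. Taking for `a` an optimal root of a key polynomial `Q` yields `ν_Q`, and
since a key polynomial exists with `δ(Q) ≥ νbar (x - b)` for every `b`, every value of `ν` is
attained.

Two facts remain: the restriction to `K[x]` really is the truncation at `Q`, and it is
residue-transcendental. For both, lower the value of `x - a` by an infinitesimal, that is, take
values in `Γ ×ₗ ℤ`. The roots of polynomials of smaller degree than `Q` are strictly farther away
from `x` than `a` is and do not notice the change, whereas the value of `Q` acquires a negative
second component. Hence the terms of a `Q`-expansion have distinct values, and no cancellation can
occur. In the same way, if `n • ν_Q(Q)` is the value of a constant `c`, there is no cancellation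
between the terms of a polynomial in `c⁻¹ Qⁿ`, whose residue is therefore transcendental.

Finally, a maximal element of a chain with least upper bound `ν` is equal to `ν`, which is not
residue-transcendental.
-/

noncomputable section

namespace KeyPoly

theorem map_sum_eq_inf {R Γ₀ ι : Type*} [Ring R] [LinearOrderedAddCommMonoidWithTop Γ₀]
    (v : AddValuation R Γ₀) {s : Finset ι} {h : ι → R}
    (hd : (s : Set ι).Pairwise fun i j => v (h i) = v (h j) → v (h i) = ⊤) :
    v (∑ i ∈ s, h i) = s.inf fun i => v (h i) := by
  classical
  induction s using Finset.induction_on with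
  | empty => simp
  | insert a s ha ih =>
    rw [Finset.coe_insert] at hd
    rw [Finset.sum_insert ha, Finset.inf_insert, ← ih (hd.mono (Set.subset_insert _ _))]
    by_cases heq : v (h a) = v (∑ i ∈ s, h i)
    · have htop : v (h a) = ⊤ := by
        rcases s.eq_empty_or_nonempty with rfl | hs
        · simpa using heq
        · obtain ⟨j, hj, hinf⟩ := s.exists_mem_eq_inf hs fun i => v (h i)
          refine hd (Set.mem_insert _ _) (Set.mem_insert_of_mem _ hj)
            (ne_of_mem_of_not_mem hj ha).symm ?_
          rw [heq, ih (hd.mono (Set.subset_insert _ _)), hinf]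
      rw [← heq, htop, inf_idem, eq_top_iff]
      exact v.map_le_add htop.ge (heq ▸ htop).ge
    · exact v.map_add_of_distinct_val heq

theorem nsmul_lt_nsmul_of_lt {Γ₀ : Type*} [LinearOrderedAddCommMonoidWithTop Γ₀] {a b : Γ₀}
    (hab : a < b) {n : ℕ} (hn : n ≠ 0) : n • a < n • b := by
  induction n, Nat.one_le_iff_ne_zero.2 hn using Nat.le_induction with
  | base => simpa using hab
  | succ n hn' ih =>
    have ih := ih (by omega)
    rw [succ_nsmul, succ_nsmul]
    exact (add_left_strictMono_of_ne_top hab.ne_top ih).trans_le (add_le_add_right hab.le _)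

/-! ### Gauss valuations -/

section Gauss

variable {R G : Type*} [Ring R] [LinearOrderedAddCommMonoidWithTop G]

/-- The value `min (v cᵢ + i γ)` of a polynomial `∑ cᵢ xⁱ`. -/
def gaussFun (v : AddValuation R G) (γ : G) (f : R[X]) : G :=
  f.support.inf fun i => v (f.coeff i) + i • γ

variable {v : AddValuation R G} {γ : G}

theorem le_gaussFun_iff {f : R[X]} {b : G} :
    b ≤ gaussFun v γ f ↔ ∀ i, b ≤ v (f.coeff i) + i • γ := by
  rw [gaussFun, Finset.le_inf_iff]
  refine ⟨fun h i => ?_, fun h i _ => h i⟩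
  by_cases hi : f.coeff i = 0
  · simp [hi]
  · exact h i (mem_support_iff.2 hi)

theorem gaussFun_le (f : R[X]) (i : ℕ) : gaussFun v γ f ≤ v (f.coeff i) + i • γ :=
  le_gaussFun_iff.1 le_rfl i

theorem exists_least_gaussFun_eq {f : R[X]} (hf : gaussFun v γ f ≠ ⊤) :
    ∃ i, gaussFun v γ f = v (f.coeff i) + i • γ ∧
      ∀ j < i, gaussFun v γ f < v (f.coeff j) + j • γ := by
  classical
  have hs : f.support.Nonempty := nonempty_support_iff.2 fun h => hf (by simp [h, gaussFun])
  have hex : ∃ i, gaussFun v γ f = v (f.coeff i) + i • γ := by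
    obtain ⟨i, -, hi⟩ := f.support.exists_mem_eq_inf hs fun i => v (f.coeff i) + i • γ
    exact ⟨i, hi⟩
  exact ⟨Nat.find hex, Nat.find_spec hex, fun j hj =>
    (gaussFun_le f j).lt_of_ne (Nat.find_min hex hj)⟩

theorem map_mul_add_nsmul_add (r s : R) (i j : ℕ) :
    v (r * s) + (i + j) • γ = (v r + i • γ) + (v s + j • γ) := by
  rw [v.map_mul, add_smul, add_add_add_comm]

theorem le_gaussFun_mul (f g : R[X]) :
    gaussFun v γ f + gaussFun v γ g ≤ gaussFun v γ (f * g) := by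
  refine le_gaussFun_iff.2 fun n => ?_
  obtain ⟨x, hx, hmin⟩ := (Finset.HasAntidiagonal.antidiagonal n).exists_min_image
    (fun x => v (f.coeff x.1 * g.coeff x.2)) ⟨(0, n), by simp⟩
  calc gaussFun v γ f + gaussFun v γ g
      ≤ (v (f.coeff x.1) + x.1 • γ) + (v (g.coeff x.2) + x.2 • γ) :=
        add_le_add (gaussFun_le f _) (gaussFun_le g _)
    _ = v (f.coeff x.1 * g.coeff x.2) + n • γ := by
        rw [← map_mul_add_nsmul_add, Finset.HasAntidiagonal.mem_antidiagonal.1 hx]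
    _ ≤ v ((f * g).coeff n) + n • γ := by
        rw [coeff_mul]
        exact add_le_add_left (v.map_le_sum hmin) _

theorem map_coeff_mul_eq_of_least {f g : R[X]} {i j : ℕ}
    (hfg : gaussFun v γ f + gaussFun v γ g ≠ ⊤)
    (hi : gaussFun v γ f = v (f.coeff i) + i • γ)
    (hi' : ∀ k < i, gaussFun v γ f < v (f.coeff k) + k • γ)
    (hj : gaussFun v γ g = v (g.coeff j) + j • γ)
    (hj' : ∀ k < j, gaussFun v γ g < v (g.coeff k) + k • γ) :
    v ((f * g).coeff (i + j)) = v (f.coeff i * g.coeff j) := by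
  have hmem : (i, j) ∈ Finset.HasAntidiagonal.antidiagonal (i + j) := by simp
  rw [coeff_mul, ← Finset.add_sum_erase _ _ hmem]
  have hval : gaussFun v γ f + gaussFun v γ g = v (f.coeff i * g.coeff j) + (i + j) • γ := by
    rw [map_mul_add_nsmul_add, hi, hj]
  refine v.map_add_eq_of_lt_left (v.map_lt_sum (fun h => hfg (by rw [hval, h, top_add])) ?_)
  intro x hx
  obtain ⟨hne, hx⟩ := Finset.mem_erase.1 hx
  rw [Finset.HasAntidiagonal.mem_antidiagonal] at hx
  have hf : gaussFun v γ f ≠ ⊤ := fun h => hfg (by rw [h, top_add])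
  have hg : gaussFun v γ g ≠ ⊤ := fun h => hfg (by rw [h, add_top])
  refine lt_of_add_lt_add_right (a := (i + j) • γ) ?_
  rw [← hval, ← hx, map_mul_add_nsmul_add]
  rcases lt_trichotomy x.1 i with h | h | h
  · exact (add_left_strictMono_of_ne_top hg (hi' _ h)).trans_le
      (add_le_add_right (gaussFun_le g _) _)
  · exact absurd (Prod.ext h (by omega)) hne
  · exact (add_right_strictMono_of_ne_top hf (hj' x.2 (by omega))).trans_le
      (add_le_add_left (gaussFun_le f _) _)

theorem gaussFun_mul (f g : R[X]) :
    gaussFun v γ (f * g) = gaussFun v γ f + gaussFun v γ g := by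
  refine le_antisymm ?_ (le_gaussFun_mul f g)
  by_cases hfg : gaussFun v γ f + gaussFun v γ g = ⊤
  · exact hfg ▸ le_top
  obtain ⟨i, hi, hi'⟩ := exists_least_gaussFun_eq (f := f) fun h => hfg (by rw [h, top_add])
  obtain ⟨j, hj, hj'⟩ := exists_least_gaussFun_eq (f := g) fun h => hfg (by rw [h, add_top])
  calc gaussFun v γ (f * g)
      ≤ v ((f * g).coeff (i + j)) + (i + j) • γ := gaussFun_le _ _
    _ = gaussFun v γ f + gaussFun v γ g := by
        rw [map_coeff_mul_eq_of_least hfg hi hi' hj hj', map_mul_add_nsmul_add, hi, hj]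

theorem min_gaussFun_le_add (f g : R[X]) :
    min (gaussFun v γ f) (gaussFun v γ g) ≤ gaussFun v γ (f + g) := by
  refine le_gaussFun_iff.2 fun i => ?_
  calc min (gaussFun v γ f) (gaussFun v γ g)
      ≤ min (v (f.coeff i) + i • γ) (v (g.coeff i) + i • γ) :=
        min_le_min (gaussFun_le f i) (gaussFun_le g i)
    _ = min (v (f.coeff i)) (v (g.coeff i)) + i • γ := (min_add _ _ _).symm
    _ ≤ v ((f + g).coeff i) + i • γ := by
        rw [coeff_add]
        exact add_le_add_left (v.map_add _ _) _

theorem gaussFun_C (c : R) : gaussFun v γ (C c) = v c := by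
  refine le_antisymm ((gaussFun_le _ 0).trans_eq (by simp)) (le_gaussFun_iff.2 fun i => ?_)
  rcases i with _ | i <;> simp [coeff_C]

/-- The Gauss valuation on `R[x]` that extends `v` and takes the value `γ` at `x`. -/
def gaussValuation (v : AddValuation R G) (γ : G) : AddValuation R[X] G :=
  AddValuation.of (gaussFun v γ) (by simp [gaussFun])
    (by rw [← C_1, gaussFun_C, v.map_one]) min_gaussFun_le_add gaussFun_mul

theorem gaussValuation_C (c : R) : gaussValuation v γ (C c) = v c :=
  gaussFun_C c

theorem gaussFun_X_add_C (c : R) : gaussFun v γ (X + C c) = min γ (v c) := by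
  refine le_antisymm (le_min ?_ ?_) (le_gaussFun_iff.2 fun i => ?_)
  · exact (gaussFun_le _ 1).trans_eq (by simp)
  · exact (gaussFun_le _ 0).trans_eq (by simp)
  · rcases i with _ | _ | i <;> simp [coeff_X, coeff_C]

theorem gaussValuation_X_add_C (c : R) :
    gaussValuation v γ (X + C c) = min γ (v c) :=
  gaussFun_X_add_C c

end Gauss

section Centered

variable {R G : Type*} [CommRing R] [LinearOrderedAddCommMonoidWithTop G]
  {v : AddValuation R G} {γ : G}

/-- The Gauss valuation on `R[x]` with centre `a`: it takes the value `min (v cᵢ + i γ)` at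
`∑ cᵢ (x - a)ⁱ`. -/
def gaussValuationAt (v : AddValuation R G) (a : R) (γ : G) : AddValuation R[X] G :=
  (gaussValuation v γ).comap (taylorAlgHom a).toRingHom

theorem gaussValuationAt_C (a c : R) : gaussValuationAt v a γ (C c) = v c := by
  change gaussValuation v γ (taylor a (C c)) = _
  rw [taylor_C, gaussValuation_C]

theorem gaussValuationAt_X_sub_C (a b : R) :
    gaussValuationAt v a γ (X - C b) = min γ (v (a - b)) := by
  change gaussValuation v γ (taylor a (X - C b)) = _
  rw [map_sub, taylor_X, taylor_C, add_sub_assoc, ← C_sub, gaussValuation_X_add_C]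

end Centered

/-! ### Extension of valuations to algebraic field extensions -/

section Extension

variable {F L : Type*} [Field F] [Field L] [Algebra F L]

theorem exists_valuationSubring_hasExtension {Γ₀ : Type*} [LinearOrderedCommGroupWithZero Γ₀]
    (v : Valuation F Γ₀) : ∃ B : ValuationSubring L, v.HasExtension B.valuation := by
  obtain ⟨B, hB, hloc⟩ := IsLocalRing.exists_factor_valuationRing
    ((algebraMap F L).comp v.valuationSubring.subtype)
  refine ⟨B, Valuation.HasExtension.ofComapInteger (Subring.ext fun c => ?_)⟩
  rw [Subring.mem_comap, Valuation.mem_integer_iff, Valuation.mem_integer_iff,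
    B.valuation_le_one_iff]
  refine ⟨fun hc => ?_, fun hc => hB ⟨c, hc⟩⟩
  by_contra! hlt
  have hc0 : c ≠ 0 := by rintro rfl; simp at hlt
  have hinv : v c⁻¹ < 1 := by rw [map_inv₀]; exact inv_lt_one_of_one_lt₀ hlt
  have hunit : IsUnit (⟨c⁻¹, hinv.le⟩ : v.valuationSubring) := by
    refine hloc.map_nonunit _ (IsUnit.of_mul_eq_one ⟨algebraMap F L c, hc⟩ (Subtype.ext ?_))
    change algebraMap F L c⁻¹ * algebraMap F L c = 1
    rw [← map_mul, inv_mul_cancel₀ hc0, map_one]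
  exact hinv.ne ((Valuation.integer.integers v).one_of_isUnit hunit)

theorem nsmul_map_eq_map_div {G : Type*} [LinearOrderedAddCommGroupWithTop G]
    {u : AddValuation L G} {a b y : L} (hb : b ≠ 0) (hy : y ≠ 0) {i j : ℕ} (hij : i ≤ j)
    (h : u (a * y ^ i) = u (b * y ^ j)) : (j - i) • u y = u (a / b) := by
  refine (add_right_inj_of_ne_top
    (u.ne_top_iff.2 (mul_ne_zero hb (pow_ne_zero i hy)))).1 ?_
  calc u (b * y ^ i) + (j - i) • u y = u (b * y ^ i * y ^ (j - i)) := by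
        rw [u.map_mul (b * y ^ i), u.map_pow]
    _ = u (b * y ^ j) := by rw [mul_assoc, ← pow_add, Nat.add_sub_cancel' hij]
    _ = u (b * y ^ i * (a / b)) := by rw [← h]; congr 1; field_simp
    _ = u (b * y ^ i) + u (a / b) := u.map_mul _ _

theorem exists_nsmul_map_eq [Algebra.IsAlgebraic F L] {G : Type*}
    [LinearOrderedAddCommGroupWithTop G] (u : AddValuation L G) (y : L) :
    ∃ n : ℕ, n ≠ 0 ∧ ∃ c : F, n • u y = u (algebraMap F L c) := by
  rcases eq_or_ne y 0 with rfl | hy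
  · exact ⟨1, one_ne_zero, 0, by rw [one_nsmul, (algebraMap F L).map_zero]⟩
  obtain ⟨p, hp0, hp⟩ := Algebra.IsAlgebraic.isAlgebraic (R := F) y
  by_contra! hcon
  have hdistinct : ∀ i j, i < j → p.coeff j ≠ 0 →
      u (algebraMap F L (p.coeff i) * y ^ i) ≠ u (algebraMap F L (p.coeff j) * y ^ j) := by
    intro i j hij hj h
    refine hcon (j - i) (by omega) (p.coeff i / p.coeff j) ?_
    rw [map_div₀, nsmul_map_eq_map_div (by simpa using hj) hy hij.le h]
  have hsum : ∑ i ∈ p.support, algebraMap F L (p.coeff i) * y ^ i = 0 := by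
    rw [← hp, aeval_def, eval₂_eq_sum, Polynomial.sum]
  have hinf := map_sum_eq_inf u (s := p.support) (h := fun i => algebraMap F L (p.coeff i) * y ^ i)
    fun i hi j hj hij h => by
      rcases lt_or_gt_of_ne hij with h' | h'
      · exact absurd h (hdistinct i j h' (mem_support_iff.1 hj))
      · exact absurd h.symm (hdistinct j i h' (mem_support_iff.1 hi))
  rw [hsum, u.map_zero, eq_comm, Finset.inf_eq_top_iff] at hinf
  obtain ⟨i, hi⟩ := nonempty_support_iff.2 hp0
  refine u.ne_top_iff.2 (mul_ne_zero ?_ (pow_ne_zero i hy)) (hinf i hi)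
  simpa using hi

variable {Γ G : Type*} [AddCommGroup Γ] [LinearOrder Γ] [IsOrderedAddMonoid Γ]
  [LinearOrderedAddCommGroupWithTop G]

/-- `γ` is the value of `y` that is forced by `v`, if some positive multiple of `u y` is the value
under `u` of an element `c` of `F` and the same multiple of `γ` is `v c`. -/
def IsForcedValue (v : AddValuation F (WithTop Γ)) (u : AddValuation L G) (y : L)
    (γ : WithTop Γ) : Prop :=
  ∃ n : ℕ, n ≠ 0 ∧ ∃ c : F, n • u y = u (algebraMap F L c) ∧ n • γ = v c

variable {v : AddValuation F (WithTop Γ)} {u : AddValuation L G}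

theorem isForcedValue_algebraMap (c : F) : IsForcedValue v u (algebraMap F L c) (v c) :=
  ⟨1, one_ne_zero, c, one_nsmul _, one_nsmul _⟩

theorem IsForcedValue.mul {y z : L} {γ η : WithTop Γ} (hy : IsForcedValue v u y γ)
    (hz : IsForcedValue v u z η) : IsForcedValue v u (y * z) (γ + η) := by
  obtain ⟨n, hn, c, hc, hγ⟩ := hy
  obtain ⟨m, hm, d, hd, hη⟩ := hz
  refine ⟨m * n, mul_ne_zero hm hn, c ^ m * d ^ n, ?_, ?_⟩
  · rw [(algebraMap F L).map_mul, map_pow, map_pow, u.map_mul, u.map_mul, u.map_pow, u.map_pow,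
      ← hc, ← hd, nsmul_add, mul_nsmul', mul_nsmul]
  · rw [v.map_mul, v.map_pow, v.map_pow, ← hγ, ← hη, nsmul_add, mul_nsmul', mul_nsmul]

theorem IsForcedValue.le (huv : ∀ c d : F, u (algebraMap F L c) ≤ u (algebraMap F L d) → v c ≤ v d)
    {y z : L} {γ η : WithTop Γ} (hy : IsForcedValue v u y γ) (hz : IsForcedValue v u z η)
    (hyz : u y ≤ u z) : γ ≤ η := by
  obtain ⟨n, hn, c, hc, hγ⟩ := hy
  obtain ⟨m, hm, d, hd, hη⟩ := hz
  have huc : u (algebraMap F L (c ^ m)) = (m * n) • u y := by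
    rw [map_pow, u.map_pow, ← hc, mul_nsmul']
  have hud : u (algebraMap F L (d ^ n)) = (m * n) • u z := by
    rw [map_pow, u.map_pow, ← hd, mul_nsmul]
  have hle : (m * n) • γ ≤ (m * n) • η := by
    have h := huv (c ^ m) (d ^ n) (by rw [huc, hud]; exact nsmul_le_nsmul_right hyz _)
    rwa [v.map_pow, v.map_pow, ← hγ, ← hη, ← mul_nsmul', ← mul_nsmul] at h
  by_contra! hlt
  exact (nsmul_lt_nsmul_of_lt hlt (mul_ne_zero hm hn)).not_ge hle

theorem exists_isForcedValue [Algebra.IsAlgebraic F L]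
    (hΓ : ∀ n : ℕ, n ≠ 0 → ∀ γ : Γ, ∃ γ' : Γ, n • γ' = γ) (v : AddValuation F (WithTop Γ))
    (u : AddValuation L G) (y : L) : ∃ γ, IsForcedValue v u y γ := by
  obtain ⟨n, hn, c, hc⟩ := exists_nsmul_map_eq (F := F) u y
  obtain ⟨γ, hγ⟩ : ∃ γ : WithTop Γ, n • γ = v c := by
    induction v c with
    | top =>
      refine ⟨⊤, ?_⟩
      obtain ⟨k, rfl⟩ := Nat.exists_eq_succ_of_ne_zero hn
      rw [succ_nsmul, add_top]
    | coe δ =>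
      obtain ⟨γ, hγ⟩ := hΓ n hn δ
      exact ⟨γ, by rw [← WithTop.coe_nsmul, hγ]⟩
  exact ⟨γ, n, hn, c, hc, hγ⟩

theorem exists_algebraic_extension [Algebra.IsAlgebraic F L]
    (hΓ : ∀ n : ℕ, n ≠ 0 → ∀ γ : Γ, ∃ γ' : Γ, n • γ' = γ) (v : AddValuation F (WithTop Γ)) :
    ∃ w : AddValuation L (WithTop Γ), ∀ c : F, w (algebraMap F L c) = v c := by
  obtain ⟨B, hB⟩ := exists_valuationSubring_hasExtension (L := L) (AddValuation.toValuation v)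
  let u := B.valuation.toAddValuation
  have huv : ∀ c d : F, u (algebraMap F L c) ≤ u (algebraMap F L d) → v c ≤ v d := fun c d h =>
    (Valuation.HasExtension.val_map_le_iff (AddValuation.toValuation v) B.valuation d c).1 h
  choose w hw using exists_isForcedValue hΓ v u
  have hw_mono : ∀ {y z : L}, u y ≤ u z → w y ≤ w z := fun h => (hw _).le huv (hw _) h
  have hw_unique : ∀ {y : L} {γ : WithTop Γ}, IsForcedValue v u y γ → w y = γ := fun h =>
    le_antisymm ((hw _).le huv h le_rfl) (h.le huv (hw _) le_rfl)
  have hw_algebraMap (c : F) : w (algebraMap F L c) = v c := hw_unique (isForcedValue_algebraMap c)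
  exact ⟨AddValuation.of w (by simpa using hw_algebraMap 0) (by simpa using hw_algebraMap 1)
    (fun y z => min_le_iff.2 ((u.map_add' y z).imp hw_mono hw_mono))
    (fun y z => hw_unique ((hw y).mul (hw z))), hw_algebraMap⟩

end Extension

section Closure

variable {K Γ : Type*} [Field K] [AddCommGroup Γ] [LinearOrder Γ] [IsOrderedAddMonoid Γ]

theorem fracValuation_algebraMap {ν : AddValuation K[X] (WithTop Γ)} (hν : IsKrull ν) (f : K[X]) :
    fracValuation ν hν (algebraMap K[X] (RatFunc K) f) = AddValuation.toValuation ν f :=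
  Valuation.extendToLocalization_apply_map_apply (AddValuation.toValuation ν)
    hν.le_primeCompl (RatFunc K) f

theorem exists_extendsToClosure (hΓ : ∀ n : ℕ, n ≠ 0 → ∀ γ : Γ, ∃ γ' : Γ, n • γ' = γ)
    {ν : AddValuation K[X] (WithTop Γ)} (hν : IsKrull ν) :
    ∃ νbar : AddValuation (AlgebraicClosure K)[X] (WithTop Γ), ExtendsToClosure νbar ν := by
  let E := AlgebraicClosure (RatFunc K)
  obtain ⟨w, hw⟩ := exists_algebraic_extension (L := E) hΓ
    (AddValuation.ofValuation (fracValuation ν hν))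
  let φ : AlgebraicClosure K →ₐ[K] E := IsAlgClosed.lift
  let ψ : (AlgebraicClosure K)[X] →+* E := eval₂RingHom φ.toRingHom (algebraMap K[X] E X)
  have hψ : ψ.comp (mapRingHom (algebraMap K (AlgebraicClosure K))) = algebraMap K[X] E := by
    refine Polynomial.ringHom_ext (fun c => ?_) ?_
    · simpa [ψ] using IsScalarTower.algebraMap_apply K K[X] E c
    · simp [ψ]
  refine ⟨w.comap ψ, fun f => ?_⟩
  calc w (ψ (f.map _)) = w (algebraMap K[X] E f) := congrArg w (DFunLike.congr_fun hψ f)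
    _ = ν f := by
      rw [IsScalarTower.algebraMap_apply K[X] (RatFunc K) E, hw]
      exact fracValuation_algebraMap hν f

end Closure

/-! ### Valuations with infinitesimal perturbations -/

section Lex

variable {Γ : Type*} [AddCommGroup Γ] [LinearOrder Γ]

/-- The embedding `γ ↦ (γ, 0)` of `Γ ∪ {∞}` into `Γ ×ₗ ℤ ∪ {∞}`. -/
def lexInl : WithTop Γ →+ WithTop (Γ ×ₗ ℤ) :=
  (OrderAddMonoidHom.inlₗ Γ ℤ).toAddMonoidHom.withTopMap

/-- The first component, as a map from `Γ ×ₗ ℤ ∪ {∞}` to `Γ ∪ {∞}`. -/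
def lexFst : WithTop (Γ ×ₗ ℤ) →+ WithTop Γ :=
  (OrderAddMonoidHom.fstₗ Γ ℤ).toAddMonoidHom.withTopMap

/-- The infinitesimal `(0, -1)`, less than `0` but greater than every negative element of `Γ`. -/
def negInfinitesimal : WithTop (Γ ×ₗ ℤ) :=
  (toLex (0, -1) : Γ ×ₗ ℤ)

theorem lexFst_lexInl (a : WithTop Γ) : lexFst (lexInl a) = a := by
  cases a <;> rfl

theorem lexInl_ne_top {a : WithTop Γ} : lexInl a ≠ ⊤ ↔ a ≠ ⊤ := by
  cases a
  · exact iff_of_false (not_not.2 rfl) (not_not.2 rfl)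
  · exact iff_of_true WithTop.coe_ne_top WithTop.coe_ne_top

theorem lexFst_negInfinitesimal : lexFst (negInfinitesimal (Γ := Γ)) = 0 := rfl

theorem lexFst_monotone : Monotone (lexFst (Γ := Γ)) :=
  WithTop.monotone_map_iff.2 (OrderAddMonoidHom.fstₗ Γ ℤ).monotone'

theorem lexInl_monotone : Monotone (lexInl (Γ := Γ)) :=
  WithTop.monotone_map_iff.2 (OrderAddMonoidHom.inlₗ Γ ℤ).monotone'

theorem lexInl_coe_add_negInfinitesimal (a : Γ) :
    lexInl a + negInfinitesimal = ((toLex (a, -1) : Γ ×ₗ ℤ) : WithTop (Γ ×ₗ ℤ)) :=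
  congrArg (fun p : Γ × ℤ => ((toLex p : Γ ×ₗ ℤ) : WithTop (Γ ×ₗ ℤ)))
    (Prod.ext (add_zero a) (zero_add (-1)))

theorem negInfinitesimal_neg : negInfinitesimal (Γ := Γ) < 0 :=
  WithTop.coe_lt_coe.2 (Prod.Lex.toLex_lt_toLex.2 (Or.inr ⟨rfl, neg_one_lt_zero⟩))

theorem lexInl_lt_lexInl_add_negInfinitesimal {a b : WithTop Γ} (hab : a < b) :
    lexInl a < lexInl b + negInfinitesimal := by
  lift a to Γ using hab.ne_top
  cases b with
  | top => exact WithTop.coe_lt_top _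
  | coe b =>
    rw [lexInl_coe_add_negInfinitesimal]
    exact WithTop.coe_lt_coe.2 (Prod.Lex.toLex_lt_toLex.2 (Or.inl (WithTop.coe_lt_coe.1 hab)))

theorem lexInl_add_nsmul_eq_top {x : WithTop (Γ ×ₗ ℤ)} (hx : x < lexInl (lexFst x))
    {a b : WithTop Γ} {i j : ℕ} (hij : i ≠ j) (h : lexInl a + i • x = lexInl b + j • x) :
    lexInl a + i • x = ⊤ := by
  lift x to Γ ×ₗ ℤ using hx.ne_top
  have hx2 : (ofLex x).2 < 0 := by
    simpa using (Prod.Lex.lt_iff.1 (WithTop.coe_lt_coe.1 hx))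
  cases a with
  | top => exact WithTop.top_add _
  | coe a =>
    cases b with
    | top => exact h.trans (WithTop.top_add _)
    | coe b =>
      have h2 : (0 : ℤ) + i • (ofLex x).2 = 0 + j • (ofLex x).2 :=
        congrArg (fun p : Γ ×ₗ ℤ => (ofLex p).2) (WithTop.coe_injective h)
      refine absurd ?_ hij
      simpa [hx2.ne] using h2

variable [IsOrderedAddMonoid Γ] {R : Type*} [Ring R]

/-- The valuation `ν`, with its values read in the first factor of `Γ ×ₗ ℤ`. -/
def lexInlValuation (ν : AddValuation R (WithTop Γ)) : AddValuation R (WithTop (Γ ×ₗ ℤ)) :=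
  ν.map lexInl rfl lexInl_monotone

/-- The coarsening of `W` formed by the first components of its values. -/
def lexFstValuation (W : AddValuation R (WithTop (Γ ×ₗ ℤ))) : AddValuation R (WithTop Γ) :=
  W.map lexFst rfl lexFst_monotone

theorem lexInlValuation_apply (ν : AddValuation R (WithTop Γ)) (f : R) :
    lexInlValuation ν f = lexInl (ν f) := rfl

theorem lexFstValuation_apply (W : AddValuation R (WithTop (Γ ×ₗ ℤ))) (f : R) :
    lexFstValuation W f = lexFst (W f) := rfl

theorem map_sum_mul_pow_eq_inf (W : AddValuation R (WithTop (Γ ×ₗ ℤ))) {y : R}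
    (hy : W y < lexInl (lexFst (W y))) (s : Finset ℕ) {c : ℕ → R}
    (hc : ∀ i ∈ s, W (c i) ∈ Set.range lexInl) :
    W (∑ i ∈ s, c i * y ^ i) = s.inf fun i => W (c i * y ^ i) := by
  refine map_sum_eq_inf W fun i hi j hj hij h => ?_
  obtain ⟨a, ha⟩ := hc i hi
  obtain ⟨b, hb⟩ := hc j hj
  rw [W.map_mul, W.map_mul, W.map_pow, W.map_pow, ← ha, ← hb] at h
  rw [W.map_mul, W.map_pow, ← ha]
  exact lexInl_add_nsmul_eq_top hy hij h

theorem lexFstValuation_sum_mul_pow (W : AddValuation R (WithTop (Γ ×ₗ ℤ))) {y : R}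
    (hy : W y < lexInl (lexFst (W y))) (s : Finset ℕ) {c : ℕ → R}
    (hc : ∀ i ∈ s, W (c i) ∈ Set.range lexInl) :
    lexFstValuation W (∑ i ∈ s, c i * y ^ i) =
      s.inf fun i => lexFstValuation W (c i * y ^ i) := by
  rw [lexFstValuation_apply, map_sum_mul_pow_eq_inf W hy s hc]
  exact Finset.apply_inf_eq_inf_comp_of_linearOrder lexFst lexFst_monotone rfl

end Lex

section Roots

theorem min_map_X_sub_C {R G : Type*} [Ring R] [LinearOrderedAddCommMonoidWithTop G]
    (ν : AddValuation R[X] G) (a b : R) :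
    min (ν (X - C a)) (ν (X - C b)) = min (ν (X - C a)) (ν (C (a - b))) := by
  refine le_antisymm (le_min (min_le_left _ _) ?_) (le_min (min_le_left _ _) ?_)
  · calc min (ν (X - C a)) (ν (X - C b)) ≤ ν (X - C b - (X - C a)) := by
          rw [min_comm]; exact ν.map_sub _ _
      _ = ν (C (a - b)) := by rw [C_sub, sub_sub_sub_cancel_left]
  · calc min (ν (X - C a)) (ν (C (a - b))) ≤ ν (X - C a + C (a - b)) := ν.map_add _ _
      _ = ν (X - C b) := by rw [C_sub, sub_add_sub_cancel]

variable {L G : Type*} [Field L] [LinearOrderedAddCommMonoidWithTop G]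

theorem map_eq_add_sum_roots [IsAlgClosed L] (μ : AddValuation L[X] G) (f : L[X]) :
    μ f = μ (C f.leadingCoeff) + (f.roots.map fun b => μ (X - C b)).sum := by
  conv_lhs => rw [(IsAlgClosed.splits f).eq_prod_roots]
  rw [μ.map_mul]
  congr 1
  induction f.roots using Multiset.induction_on with
  | empty => simp
  | cons b s ih =>
    rw [Multiset.map_cons, Multiset.prod_cons, μ.map_mul, ih, Multiset.map_cons, Multiset.sum_cons]

theorem map_le_map_of_forall_roots [IsAlgClosed L] {μ η : AddValuation L[X] G}
    (hC : ∀ c, μ (C c) ≤ η (C c)) {f : L[X]}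
    (hroots : ∀ b ∈ f.roots, μ (X - C b) ≤ η (X - C b)) : μ f ≤ η f := by
  rw [map_eq_add_sum_roots μ, map_eq_add_sum_roots η]
  exact add_le_add (hC _) (Multiset.sum_map_le_sum_map _ _ hroots)

variable {Γ : Type*} [AddCommGroup Γ] [LinearOrder Γ] [IsOrderedAddMonoid Γ]

/-- The Gauss valuation with centre `a` that agrees with `ν` on constants and whose value at
`x - a` is infinitesimally smaller than `ν (x - a)`. -/
def lexGauss (ν : AddValuation L[X] (WithTop Γ)) (a : L) : AddValuation L[X] (WithTop (Γ ×ₗ ℤ)) :=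
  gaussValuationAt (lexInlValuation (ν.comap C)) a (lexInl (ν (X - C a)) + negInfinitesimal)

/-- The Gauss valuation with centre `a` that agrees with `ν` on constants and at `x - a`: the
truncation of `ν` at `x - a`. -/
def linearTruncation (ν : AddValuation L[X] (WithTop Γ)) (a : L) : AddValuation L[X] (WithTop Γ) :=
  lexFstValuation (lexGauss ν a)

variable {ν : AddValuation L[X] (WithTop Γ)} {a b : L}

theorem lexGauss_C (c : L) : lexGauss ν a (C c) = lexInl (ν (C c)) :=
  gaussValuationAt_C a c

theorem lexGauss_X_sub_C (b : L) : lexGauss ν a (X - C b) =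
    min (lexInl (ν (X - C a)) + negInfinitesimal) (lexInl (ν (C (a - b)))) :=
  gaussValuationAt_X_sub_C a b

theorem lexGauss_X_sub_C_self :
    lexGauss ν a (X - C a) = lexInl (ν (X - C a)) + negInfinitesimal := by
  rw [lexGauss_X_sub_C, sub_self, C_0, ν.map_zero]
  exact min_top_right _

theorem lexGauss_X_sub_C_of_lt (hab : ν (X - C b) < ν (X - C a)) :
    lexGauss ν a (X - C b) = lexInl (ν (X - C b)) := by
  have hC : ν (C (a - b)) = ν (X - C b) := by
    have h := min_map_X_sub_C ν a b
    rw [min_eq_right hab.le] at h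
    exact ((min_choice _ _).resolve_left (h ▸ hab.ne)).symm.trans h.symm
  rw [lexGauss_X_sub_C, hC, min_eq_right (lexInl_lt_lexInl_add_negInfinitesimal hab).le]

theorem linearTruncation_C (c : L) : linearTruncation ν a (C c) = ν (C c) := by
  rw [linearTruncation, lexFstValuation_apply, lexGauss_C, lexFst_lexInl]

theorem linearTruncation_X_sub_C (b : L) :
    linearTruncation ν a (X - C b) = min (ν (X - C a)) (ν (X - C b)) := by
  rw [linearTruncation, lexFstValuation_apply, lexGauss_X_sub_C,
    Monotone.map_min (f := lexFst) lexFst_monotone, map_add, lexFst_lexInl, lexFst_lexInl,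
    lexFst_negInfinitesimal, add_zero, min_map_X_sub_C]

variable [IsAlgClosed L]

theorem linearTruncation_le (f : L[X]) : linearTruncation ν a f ≤ ν f :=
  map_le_map_of_forall_roots (fun c => (linearTruncation_C c).le) fun b _ =>
    (linearTruncation_X_sub_C b).trans_le (min_le_right _ _)

theorem linearTruncation_mono (hab : ν (X - C a) ≤ ν (X - C b)) (f : L[X]) :
    linearTruncation ν a f ≤ linearTruncation ν b f := by
  refine map_le_map_of_forall_roots (fun c => ?_) fun d _ => ?_
  · rw [linearTruncation_C, linearTruncation_C]
  · rw [linearTruncation_X_sub_C, linearTruncation_X_sub_C]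
    exact min_le_min_right _ hab

theorem linearTruncation_eq {f : L[X]} (hf : ∀ b ∈ f.roots, ν (X - C b) ≤ ν (X - C a)) :
    linearTruncation ν a f = ν f :=
  (linearTruncation_le f).antisymm <|
    map_le_map_of_forall_roots (fun c => (linearTruncation_C c).ge) fun b hb => by
      rw [linearTruncation_X_sub_C, min_eq_right (hf b hb)]

theorem lexGauss_eq_lexInl {f : L[X]} (hf : ∀ b ∈ f.roots, ν (X - C b) < ν (X - C a)) :
    lexGauss ν a f = lexInl (ν f) := by
  rw [← lexInlValuation_apply]
  exact le_antisymm
    (map_le_map_of_forall_roots (fun c => (lexGauss_C c).le) fun b hb =>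
      (lexGauss_X_sub_C_of_lt (hf b hb)).le)
    (map_le_map_of_forall_roots (fun c => (lexGauss_C c).ge) fun b hb =>
      (lexGauss_X_sub_C_of_lt (hf b hb)).ge)

theorem lexGauss_le_lexInl_linearTruncation (f : L[X]) :
    lexGauss ν a f ≤ lexInl (linearTruncation ν a f) := by
  rw [← lexInlValuation_apply]
  refine map_le_map_of_forall_roots (fun c => ?_) fun b _ => ?_
  · rw [lexInlValuation_apply, linearTruncation_C, lexGauss_C]
  · rw [lexInlValuation_apply, linearTruncation_X_sub_C, min_map_X_sub_C,
      Monotone.map_min (f := lexInl) lexInl_monotone, lexGauss_X_sub_C]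
    exact min_le_min_right _ (add_le_of_nonpos_right negInfinitesimal_neg.le)

theorem lexGauss_lt_lexInl_linearTruncation {f : L[X]} (hf : ν f ≠ ⊤) (ha : f.IsRoot a) :
    lexGauss ν a f < lexInl (linearTruncation ν a f) := by
  obtain ⟨g, rfl⟩ := dvd_iff_isRoot.2 ha
  rw [ν.map_mul, WithTop.add_ne_top] at hf
  have hXa : lexGauss ν a (X - C a) < lexInl (linearTruncation ν a (X - C a)) := by
    rw [lexGauss_X_sub_C_self, linearTruncation_X_sub_C, min_self]
    calc lexInl (ν (X - C a)) + negInfinitesimal < lexInl (ν (X - C a)) + 0 :=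
          WithTop.add_lt_add_left (lexInl_ne_top.2 hf.1) negInfinitesimal_neg
      _ = lexInl (ν (X - C a)) := add_zero _
  have hg : lexGauss ν a g ≠ ⊤ := ne_top_of_le_ne_top
    (lexInl_ne_top.2 (ne_top_of_le_ne_top hf.2 (linearTruncation_le g)))
    (lexGauss_le_lexInl_linearTruncation g)
  rw [AddValuation.map_mul, AddValuation.map_mul, map_add]
  exact WithTop.add_lt_add_of_lt_of_le hg hXa (lexGauss_le_lexInl_linearTruncation g)

end Roots

/-! ### Residue-transcendental valuations -/

section Residue

theorem transcendental_residue {F E Γ₀ Γ₁ : Type*} [Field F] [Field E] [Algebra F E]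
    [LinearOrderedCommGroupWithZero Γ₀] [LinearOrderedCommGroupWithZero Γ₁]
    {v : Valuation F Γ₀} {w : Valuation E Γ₁} [v.HasExtension w] (z : w.valuationSubring)
    (hz : ∀ G : F[X], w (aeval (z : E) G) < 1 → ∀ i, v (G.coeff i) < 1) :
    Transcendental (IsLocalRing.ResidueField v.valuationSubring)
      (IsLocalRing.residue w.valuationSubring z) := by
  rw [transcendental_iff]
  intro p hp
  obtain ⟨G, rfl⟩ := map_surjective _
    (IsLocalRing.residue_surjective (R := v.valuationSubring)) p
  have hres : aeval (IsLocalRing.residue w.valuationSubring z)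
      (G.map (IsLocalRing.residue v.valuationSubring)) =
      IsLocalRing.residue w.valuationSubring (aeval z G) := by
    rw [aeval_def, eval₂_map, aeval_def, hom_eval₂]
    rfl
  have hcoe : ((aeval z G : w.valuationSubring) : E) =
      aeval (z : E) (G.map v.valuationSubring.subtype) := by
    rw [aeval_def, aeval_def, eval₂_map]
    exact hom_eval₂ G _ w.valuationSubring.subtype z
  rw [hres, IsLocalRing.residue_eq_zero_iff] at hp
  have hlt : w ((aeval z G : w.valuationSubring) : E) < 1 :=
    (Valuation.mem_maximalIdeal_iff _ _).1 hp
  ext i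
  rw [coeff_map, coeff_zero, IsLocalRing.residue_eq_zero_iff]
  refine (Valuation.mem_maximalIdeal_iff _ _).2 ?_
  have hi := hz _ (hcoe ▸ hlt) i
  rwa [coeff_map] at hi

variable {K Γ : Type*} [Field K] [AddCommGroup Γ] [LinearOrder Γ] [IsOrderedAddMonoid Γ]
  {ν₀ : AddValuation K (WithTop Γ)} {ν : ExtVal ν₀}

theorem isResidueTranscendental_of_map_eq_zero (hν : IsKrull ν.1) {z : K[X]} (hz : ν.1 z = 0)
    (hcoeff : ∀ G : K[X], 0 < ν.1 (aeval z G) → ∀ i, 0 < ν₀ (G.coeff i)) :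
    IsResidueTranscendental ν := by
  refine ⟨hν, ?_⟩
  let _ := fracValuation_hasExtension ν hν
  have hmem : algebraMap K[X] (RatFunc K) z ∈ (fracValuation ν.1 hν).valuationSubring := by
    rw [Valuation.mem_valuationSubring_iff, fracValuation_algebraMap]
    exact hz.ge
  refine ⟨_, transcendental_residue ⟨_, hmem⟩ fun G hG => hcoeff G ?_⟩
  rw [aeval_algebraMap_apply, fracValuation_algebraMap] at hG
  exact hG

theorem isResidueTranscendental_of_lt_lexInl (hν : IsKrull ν.1)
    {W : AddValuation K[X] (WithTop (Γ ×ₗ ℤ))} (hW : ∀ f, lexFstValuation W f = ν.1 f)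
    (hC : ∀ c, W (C c) = lexInl (ν₀ c)) {P : K[X]} (hP : W P < lexInl (ν.1 P)) {n : ℕ}
    (hn : n ≠ 0) {c : K} (hc : ν₀ c = n • ν.1 P) : IsResidueTranscendental ν := by
  have hc0 : c ≠ 0 := by
    rintro rfl
    rw [ν₀.map_zero, ← ν.1.map_pow] at hc
    obtain rfl := eq_zero_of_pow_eq_zero (hν _ hc.symm)
    exact hP.ne_top W.map_zero
  let z := C c⁻¹ * P ^ n
  have hz : ν.1 z = 0 := by
    rw [ν.1.map_mul, ν.1.map_pow, ← hc, ν.2, ← ν₀.map_mul, inv_mul_cancel₀ hc0, ν₀.map_one]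
  have hWz : W z < lexInl (lexFst (W z)) := by
    have hc_top : lexInl (ν₀ c⁻¹) ≠ ⊤ := lexInl_ne_top.2 (ν₀.ne_top_iff.2 (inv_ne_zero hc0))
    calc W z = lexInl (ν₀ c⁻¹) + n • W P := by rw [W.map_mul, W.map_pow, hC]
      _ < lexInl (ν₀ c⁻¹) + n • lexInl (ν.1 P) :=
        WithTop.add_lt_add_left hc_top (nsmul_lt_nsmul_of_lt hP hn)
      _ = lexInl (lexFst (W z)) := by
        rw [← lexFstValuation_apply, hW, ν.1.map_mul, ν.1.map_pow, ν.2, map_add, map_nsmul]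
  refine isResidueTranscendental_of_map_eq_zero hν hz fun G hG i => ?_
  rcases eq_or_ne (G.coeff i) 0 with hi | hi
  · rw [hi, ν₀.map_zero]
    exact WithTop.coe_lt_top 0
  have hmin : ν.1 (aeval z G) =
      (Finset.range (G.natDegree + 1)).inf fun i => ν.1 (C (G.coeff i) * z ^ i) := by
    simp only [aeval_eq_sum_range, smul_eq_C_mul, ← hW]
    exact lexFstValuation_sum_mul_pow W hWz _ fun i _ => ⟨_, (hC _).symm⟩
  calc 0 < ν.1 (aeval z G) := hG
    _ ≤ ν.1 (C (G.coeff i) * z ^ i) := hmin ▸ Finset.inf_le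
      (Finset.mem_range.2 (Nat.lt_succ_of_le (le_natDegree_of_ne_zero hi)))
    _ = ν₀ (G.coeff i) := by
      rw [ν.1.map_mul, ν.1.map_pow, hz, smul_zero, add_zero, ν.2]

end Residue

section ExtVal

variable {K Γ : Type*} [Field K] [AddCommGroup Γ] [LinearOrder Γ] [IsOrderedAddMonoid Γ]
  {ν₀ : AddValuation K (WithTop Γ)} {ν : ExtVal ν₀}

theorem IsKrull.of_le {μ : ExtVal ν₀} (hν : IsKrull ν.1) (hle : μ ≤ ν) : IsKrull μ.1 :=
  fun f hf => hν f (top_le_iff.1 (hf.ge.trans (hle f)))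

theorem mem_valueGroup_iff {γ : Γ} : γ ∈ valueGroup ν₀ ↔ ∃ c : K, ν₀ c = (γ : WithTop Γ) := by
  refine ⟨fun hγ => ?_, fun hγ => AddSubgroup.subset_closure hγ⟩
  induction hγ using AddSubgroup.closure_induction with
  | mem _ hγ => exact hγ
  | zero => exact ⟨1, ν₀.map_one⟩
  | add γ η _ _ hγ hη =>
    obtain ⟨c, hc⟩ := hγ
    obtain ⟨d, hd⟩ := hη
    exact ⟨c * d, by rw [ν₀.map_mul, hc, hd, WithTop.coe_add]⟩
  | neg γ _ hγ =>
    obtain ⟨c, hc⟩ := hγ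
    exact ⟨c⁻¹, by rw [ν₀.map_inv, hc]; rfl⟩

theorem exists_map_eq_nsmul (hν : ¬ IsValueTranscendental ν) {f : K[X]} (hf : f ≠ 0) :
    ∃ n : ℕ, n ≠ 0 ∧ ∃ c : K, ν₀ c = n • ν.1 f := by
  rw [IsValueTranscendental, not_or, not_not, not_not] at hν
  obtain ⟨hKrull, htorsion⟩ := hν
  obtain ⟨γ, hγ⟩ := WithTop.ne_top_iff_exists.1 (mt (hKrull f) hf)
  let γ' : valueGroup ν.1 := ⟨γ, AddSubgroup.subset_closure ⟨f, hγ.symm⟩⟩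
  obtain ⟨n, hn, hmem⟩ := isOfFinAddOrder_iff_nsmul_eq_zero.1
    (htorsion (QuotientAddGroup.mk γ'))
  rw [← QuotientAddGroup.mk_nsmul, QuotientAddGroup.eq_zero_iff, AddSubgroup.mem_addSubgroupOf]
    at hmem
  obtain ⟨c, hc⟩ := mem_valueGroup_iff.1 hmem
  exact ⟨n, hn.ne', c, by rw [hc, ← hγ]; rfl⟩

end ExtVal

section Expansion

variable {K : Type*} [Field K]

theorem sum_expansionCoeff_add (q f : K[X]) (n : ℕ) :
    ∑ i ∈ Finset.range n, expansionCoeff q f i * q ^ i + (fun g : K[X] => g / q)^[n] f * q ^ n =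
      f := by
  induction n with
  | zero => simp
  | succ n ih =>
    rw [Finset.sum_range_succ, Function.iterate_succ_apply']
    conv_rhs => rw [← ih, ← EuclideanDomain.div_add_mod ((fun g : K[X] => g / q)^[n] f) q]
    rw [expansionCoeff]
    ring

theorem natDegree_iterate_div_le {q : K[X]} (hq : 0 < q.natDegree) (f : K[X]) (n : ℕ) :
    ((fun g : K[X] => g / q)^[n] f).natDegree ≤ f.natDegree - n := by
  induction n with
  | zero => simp
  | succ n ih =>
    have hq0 : q ≠ 0 := ne_zero_of_natDegree_gt hq
    rw [Function.iterate_succ_apply', div_def]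
    refine (natDegree_C_mul_le _ _).trans ?_
    rw [natDegree_divByMonic _ (monic_mul_leadingCoeff_inv hq0),
      natDegree_mul_leadingCoeff_inv _ hq0]
    omega

theorem sum_expansionCoeff {q : K[X]} (hq : 0 < q.natDegree) (f : K[X]) :
    ∑ i ∈ Finset.range (f.natDegree + 1), expansionCoeff q f i * q ^ i = f := by
  have hdeg := natDegree_iterate_div_le hq f f.natDegree
  have hquot : (fun g : K[X] => g / q)^[f.natDegree + 1] f = 0 := by
    rw [Function.iterate_succ_apply', Polynomial.div_eq_zero_iff (ne_zero_of_natDegree_gt hq)]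
    exact degree_lt_degree (by omega)
  have hsum := sum_expansionCoeff_add q f (f.natDegree + 1)
  rwa [hquot, zero_mul, add_zero] at hsum

theorem natDegree_expansionCoeff_lt {q : K[X]} (hq : 0 < q.natDegree) (f : K[X]) (i : ℕ) :
    (expansionCoeff q f i).natDegree < q.natDegree :=
  natDegree_mod_lt _ hq.ne'

end Expansion

/-! ### Key polynomials -/

section Delta

variable {K Γ : Type*} [Field K] [AddCommGroup Γ] [LinearOrder Γ] [IsOrderedAddMonoid Γ]
  {νbar : AddValuation (AlgebraicClosure K)[X] (WithTop Γ)} {f : (AlgebraicClosure K)[X]}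

theorem delta_le_iff {d : WithBot (WithTop Γ)} :
    delta νbar f ≤ d ↔ ∀ b ∈ f.roots, ((νbar (X - C b) : WithTop Γ) : WithBot (WithTop Γ)) ≤ d := by
  rw [delta, Finset.sup_le_iff]
  simp only [Multiset.mem_toFinset]

theorem le_delta {b : AlgebraicClosure K} (hb : b ∈ f.roots) :
    ((νbar (X - C b) : WithTop Γ) : WithBot (WithTop Γ)) ≤ delta νbar f :=
  delta_le_iff.1 le_rfl b hb

theorem delta_C (c : AlgebraicClosure K) : delta νbar (C c) = ⊥ := by
  rw [← le_bot_iff, delta_le_iff, roots_C]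
  exact fun b hb => absurd hb (Multiset.notMem_zero b)

theorem exists_mem_roots_delta_eq (hf : 0 < f.natDegree) :
    ∃ a ∈ f.roots, delta νbar f = ((νbar (X - C a) : WithTop Γ) : WithBot (WithTop Γ)) := by
  classical
  obtain ⟨b, hb⟩ := IsAlgClosed.exists_root f (natDegree_pos_iff_degree_pos.1 hf).ne'
  have hb_mem : b ∈ f.roots.toFinset :=
    Multiset.mem_toFinset.2 ((mem_roots (ne_zero_of_natDegree_gt hf)).2 hb)
  obtain ⟨a, ha, h⟩ := Finset.exists_mem_eq_sup _ ⟨b, hb_mem⟩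
    fun a => ((νbar (X - C a) : WithTop Γ) : WithBot (WithTop Γ))
  refine ⟨a, Multiset.mem_toFinset.1 ha, ?_⟩
  rw [delta, ← h]

theorem natDegree_pos_of_le_delta {b : WithTop Γ} (h : (b : WithBot (WithTop Γ)) ≤ delta νbar f) :
    0 < f.natDegree := by
  by_contra! hdeg
  rw [eq_C_of_natDegree_eq_zero (Nat.le_zero.1 hdeg), delta_C] at h
  exact WithBot.coe_ne_bot (le_bot_iff.1 h)

theorem delta_normalize [DecidableEq (AlgebraicClosure K)] :
    delta νbar (normalize f) = delta νbar f := by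
  rw [delta, delta, roots_normalize]

end Delta

section KeyPolynomials

variable {K Γ : Type*} [Field K] [AddCommGroup Γ] [LinearOrder Γ] [IsOrderedAddMonoid Γ]
  {νbar : AddValuation (AlgebraicClosure K)[X] (WithTop Γ)} {Q : K[X]}

/-- `Q` is a key polynomial for a valuation with the given extension `νbar`, by which `δ` is
computed. -/
def IsKeyFor (νbar : AddValuation (AlgebraicClosure K)[X] (WithTop Γ)) (Q : K[X]) : Prop :=
  Q.Monic ∧ 0 < Q.natDegree ∧ ∀ f : K[X], f ≠ 0 →
    delta νbar (Q.map (algebraMap K (AlgebraicClosure K))) ≤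
      delta νbar (f.map (algebraMap K (AlgebraicClosure K))) →
    Q.natDegree ≤ f.natDegree

theorem exists_isKeyFor (νbar : AddValuation (AlgebraicClosure K)[X] (WithTop Γ))
    (a : AlgebraicClosure K) : ∃ Q : K[X], IsKeyFor νbar Q ∧
      ((νbar (X - C a) : WithTop Γ) : WithBot (WithTop Γ)) ≤
        delta νbar (Q.map (algebraMap K (AlgebraicClosure K))) := by
  classical
  have ha : IsIntegral K a := Algebra.IsIntegral.isIntegral a
  have ha_root : a ∈ ((minpoly K a).map (algebraMap K (AlgebraicClosure K))).roots := by
    rw [mem_roots ((minpoly.monic ha).map _).ne_zero, IsRoot.def, eval_map_algebraMap,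
      minpoly.aeval]
  obtain ⟨Q, hmin⟩ := exists_minimalFor_of_wellFoundedLT
    (fun f : K[X] => f.Monic ∧ ((νbar (X - C a) : WithTop Γ) : WithBot (WithTop Γ)) ≤
      delta νbar (f.map (algebraMap K (AlgebraicClosure K))))
    natDegree ⟨minpoly K a, minpoly.monic ha, le_delta ha_root⟩
  obtain ⟨hQ_monic, hQ⟩ := hmin.prop
  refine ⟨Q, ⟨hQ_monic, ?_, fun f hf hle => ?_⟩, hQ⟩
  · simpa only [natDegree_map] using natDegree_pos_of_le_delta hQ
  · have hdeg : (normalize f).natDegree = f.natDegree :=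
      natDegree_eq_of_degree_eq degree_normalize
    rw [← hdeg]
    refine le_of_not_gt (hmin.not_lt ⟨monic_normalize hf, ?_⟩)
    rw [map_normalize, delta_normalize]
    exact hQ.trans hle

theorem exists_isKeyFor_delta_le (νbar : AddValuation (AlgebraicClosure K)[X] (WithTop Γ))
    (f : (AlgebraicClosure K)[X]) : ∃ Q : K[X], IsKeyFor νbar Q ∧
      delta νbar f ≤ delta νbar (Q.map (algebraMap K (AlgebraicClosure K))) := by
  rcases Nat.eq_zero_or_pos f.natDegree with hf | hf
  · obtain ⟨Q, hQ, -⟩ := exists_isKeyFor νbar 0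
    refine ⟨Q, hQ, ?_⟩
    rw [eq_C_of_natDegree_eq_zero hf, delta_C]
    exact bot_le
  · obtain ⟨a, -, ha⟩ := exists_mem_roots_delta_eq (νbar := νbar) hf
    obtain ⟨Q, hQ, hle⟩ := exists_isKeyFor νbar a
    exact ⟨Q, hQ, ha.trans_le hle⟩

theorem IsKeyFor.delta_lt (hQ : IsKeyFor νbar Q) {g : K[X]} (hg0 : g ≠ 0)
    (hg : g.natDegree < Q.natDegree) :
    delta νbar (g.map (algebraMap K (AlgebraicClosure K))) <
      delta νbar (Q.map (algebraMap K (AlgebraicClosure K))) :=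
  lt_of_not_ge fun hle => (hQ.2.2 g hg0 hle).not_gt hg

theorem IsKeyFor.exists_center (hQ : IsKeyFor νbar Q) :
    ∃ a ∈ (Q.map (algebraMap K (AlgebraicClosure K))).roots,
      delta νbar (Q.map (algebraMap K (AlgebraicClosure K))) =
        ((νbar (X - C a) : WithTop Γ) : WithBot (WithTop Γ)) :=
  exists_mem_roots_delta_eq (by rw [natDegree_map]; exact hQ.2.1)

end KeyPolynomials

/-! ### Truncations at key polynomials -/

section CenteredTruncation

variable {K Γ : Type*} [Field K] [AddCommGroup Γ] [LinearOrder Γ] [IsOrderedAddMonoid Γ]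
  {ν₀ : AddValuation K (WithTop Γ)} {ν : ExtVal ν₀}
  {νbar : AddValuation (AlgebraicClosure K)[X] (WithTop Γ)} {a b : AlgebraicClosure K}
  {f Q : K[X]}

/-- The restriction to `K[x]` of the Gauss valuation centred at `a` that takes the same value as
`νbar` at `x - a`. -/
def centeredTruncation (hext : ExtendsToClosure νbar ν.1) (a : AlgebraicClosure K) : ExtVal ν₀ :=
  ⟨(linearTruncation νbar a).comap (mapRingHom (algebraMap K (AlgebraicClosure K))), fun c => by
    change linearTruncation νbar a ((C c).map (algebraMap K (AlgebraicClosure K))) = _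
    rw [map_C, linearTruncation_C, ← map_C, hext, ν.2]⟩

theorem centeredTruncation_apply (hext : ExtendsToClosure νbar ν.1) (f : K[X]) :
    (centeredTruncation hext a).1 f =
      linearTruncation νbar a (f.map (algebraMap K (AlgebraicClosure K))) := rfl

theorem centeredTruncation_le (hext : ExtendsToClosure νbar ν.1) :
    centeredTruncation hext a ≤ ν := fun f =>
  (centeredTruncation_apply hext f).trans_le ((linearTruncation_le _).trans_eq (hext f))

theorem centeredTruncation_mono (hext : ExtendsToClosure νbar ν.1)
    (hab : νbar (X - C a) ≤ νbar (X - C b)) :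
    centeredTruncation hext a ≤ centeredTruncation hext b := fun _ =>
  linearTruncation_mono hab _

theorem centeredTruncation_eq (hext : ExtendsToClosure νbar ν.1)
    (hf : delta νbar (f.map (algebraMap K (AlgebraicClosure K))) ≤
      ((νbar (X - C a) : WithTop Γ) : WithBot (WithTop Γ))) :
    (centeredTruncation hext a).1 f = ν.1 f := by
  rw [← hext, centeredTruncation_apply]
  exact linearTruncation_eq fun b hb => WithBot.coe_le_coe.1 (delta_le_iff.1 hf b hb)

theorem lexGauss_lt_lexInl_centeredTruncation (hext : ExtendsToClosure νbar ν.1)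
    (hν : IsKrull ν.1) (ha : a ∈ (f.map (algebraMap K (AlgebraicClosure K))).roots) :
    lexGauss νbar a (f.map (algebraMap K (AlgebraicClosure K))) <
      lexInl ((centeredTruncation hext a).1 f) := by
  refine lexGauss_lt_lexInl_linearTruncation ?_ (isRoot_of_mem_roots ha)
  rw [hext]
  refine mt (hν f) ?_
  rintro rfl
  simp at ha

theorem isResidueTranscendental_centeredTruncation (hext : ExtendsToClosure νbar ν.1)
    (hν : ¬ IsValueTranscendental ν)
    (ha : a ∈ (f.map (algebraMap K (AlgebraicClosure K))).roots)
    (hf : delta νbar (f.map (algebraMap K (AlgebraicClosure K))) ≤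
      ((νbar (X - C a) : WithTop Γ) : WithBot (WithTop Γ))) :
    IsResidueTranscendental (centeredTruncation hext a) := by
  have hKrull : IsKrull ν.1 := not_not.1 (not_or.1 hν).1
  have hf0 : f ≠ 0 := by rintro rfl; simp at ha
  obtain ⟨n, hn, c, hc⟩ := exists_map_eq_nsmul hν hf0
  rw [← centeredTruncation_eq hext hf] at hc
  refine isResidueTranscendental_of_lt_lexInl (hKrull.of_le (centeredTruncation_le hext))
    (W := (lexGauss νbar a).comap (mapRingHom (algebraMap K (AlgebraicClosure K))))
    (fun _ => rfl) (fun c => ?_) (lexGauss_lt_lexInl_centeredTruncation hext hKrull ha) hn hc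
  change lexGauss νbar a ((C c).map (algebraMap K (AlgebraicClosure K))) = _
  rw [map_C, lexGauss_C, ← map_C, hext, ν.2]

theorem centeredTruncation_eq_truncation (hext : ExtendsToClosure νbar ν.1) (hν : IsKrull ν.1)
    (hQ : IsKeyFor νbar Q) (ha : a ∈ (Q.map (algebraMap K (AlgebraicClosure K))).roots)
    (hδ : delta νbar (Q.map (algebraMap K (AlgebraicClosure K))) =
      ((νbar (X - C a) : WithTop Γ) : WithBot (WithTop Γ))) (f : K[X]) :
    (centeredTruncation hext a).1 f = truncation ν.1 Q f := by
  have hcoeff (i : ℕ) : ∀ b ∈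
      ((expansionCoeff Q f i).map (algebraMap K (AlgebraicClosure K))).roots,
      νbar (X - C b) < νbar (X - C a) := by
    intro b hb
    have hne : expansionCoeff Q f i ≠ 0 := by intro h; simp [h] at hb
    rw [← WithBot.coe_lt_coe, ← hδ]
    exact (le_delta hb).trans_lt (hQ.delta_lt hne (natDegree_expansionCoeff_lt hQ.2.1 f i))
  have hterm (i : ℕ) : (centeredTruncation hext a).1 (expansionCoeff Q f i * Q ^ i) =
      ν.1 (expansionCoeff Q f i * Q ^ i) := by
    have hi : (centeredTruncation hext a).1 (expansionCoeff Q f i) =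
        ν.1 (expansionCoeff Q f i) :=
      centeredTruncation_eq hext
        (delta_le_iff.2 fun b hb => WithBot.coe_le_coe.2 (hcoeff i b hb).le)
    rw [AddValuation.map_mul, AddValuation.map_pow, AddValuation.map_mul, AddValuation.map_pow,
      hi, centeredTruncation_eq hext hδ.le]
  let W := (lexGauss νbar a).comap (mapRingHom (algebraMap K (AlgebraicClosure K)))
  have hQW : W Q < lexInl (lexFst (W Q)) := lexGauss_lt_lexInl_centeredTruncation hext hν ha
  calc (centeredTruncation hext a).1 f
      = lexFstValuation W
          (∑ i ∈ Finset.range (f.natDegree + 1), expansionCoeff Q f i * Q ^ i) := by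
        rw [sum_expansionCoeff hQ.2.1]; rfl
    _ = (Finset.range (f.natDegree + 1)).inf fun i =>
          (centeredTruncation hext a).1 (expansionCoeff Q f i * Q ^ i) :=
        lexFstValuation_sum_mul_pow W hQW _ fun i _ => ⟨_, (lexGauss_eq_lexInl (hcoeff i)).symm⟩
    _ = truncation ν.1 Q f := Finset.inf_congr rfl fun i _ => hterm i

end CenteredTruncation

section Suprema

variable {K Γ : Type*} [Field K] [AddCommGroup Γ] [LinearOrder Γ] [IsOrderedAddMonoid Γ]
  {ν₀ : AddValuation K (WithTop Γ)} {ν μ : ExtVal ν₀} {S : Set (ExtVal ν₀)} {f : K[X]}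

theorem stableFrom_iff (hchain : IsChain (· ≤ ·) S) (hub : ν ∈ upperBounds S)
    (hf : ∃ μ ∈ S, μ.1 f = ν.1 f) : StableFrom S f μ ↔ μ ∈ S ∧ μ.1 f = ν.1 f := by
  refine ⟨fun hμ => ⟨hμ.1, ?_⟩, fun hμ => ⟨hμ.1, fun η hη hle => ?_⟩⟩
  · obtain ⟨η, hη, hηf⟩ := hf
    rcases hchain.total hμ.1 hη with hle | hle
    · rw [← hμ.2 η hη hle, hηf]
    · exact (hub hμ.1 f).antisymm (hηf.ge.trans (hle f))
  · exact ((hub hη f).trans_eq hμ.2.symm).antisymm (hle f)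

theorem isLUB_of_forall_exists_map_eq (hub : ν ∈ upperBounds S)
    (hattained : ∀ f, ∃ μ ∈ S, μ.1 f = ν.1 f) : IsLUB S ν := by
  refine ⟨hub, fun η hη f => ?_⟩
  obtain ⟨μ, hμ, hμf⟩ := hattained f
  exact hμf.ge.trans (hη hμ f)

theorem eq_of_maximal_of_isLUB (hchain : IsChain (· ≤ ·) S) (hlub : IsLUB S ν)
    (hμ : Maximal (· ∈ S) μ) : μ = ν :=
  (hlub.1 hμ.prop).antisymm <| hlub.2 fun _ hη =>
    (hchain.total hη hμ.prop).elim id (hμ.le_of_ge hη)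

end Suprema

end KeyPoly

end

theorem mainTheorem7_general {K Γ : Type*} [Field K]
    [AddCommGroup Γ] [LinearOrder Γ] [IsOrderedAddMonoid Γ]
    (hΓ : ∀ n : ℕ, n ≠ 0 → ∀ γ : Γ, ∃ γ' : Γ, n • γ' = γ)
    (ν₀ : AddValuation K (WithTop Γ)) (ν : ExtVal ν₀) (hν : ¬ IsValueTranscendental ν) :
    ∃ (QQ : Set K[X]) (νQ : QQ → ExtVal ν₀),
      (∀ Q : QQ, IsKeyPolynomial ν.1 (Q : K[X])) ∧
      (∀ (Q : QQ) (f : K[X]), (νQ Q).1 f = truncation ν.1 (Q : K[X]) f) ∧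
      IsChain (· ≤ ·) (Set.range νQ) ∧
      (∀ μ : ExtVal ν₀, Maximal (· ∈ Set.range νQ) μ → μ = ν) ∧
      (∀ f : K[X], IsStable (Set.range νQ) f) ∧
      IsStableSup (Set.range νQ) ν ∧
      IsLUB (Set.range νQ) ν ∧
      (∀ Q : QQ, IsResidueTranscendental (νQ Q)) := by
  have hKrull : IsKrull ν.1 := not_not.1 (not_or.1 hν).1
  obtain ⟨νbar, hext⟩ := exists_extendsToClosure hΓ hKrull
  choose a ha hδ using fun Q : {Q : K[X] | IsKeyFor νbar Q} => Q.2.exists_center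
  let νQ (Q : {Q : K[X] | IsKeyFor νbar Q}) : ExtVal ν₀ := centeredTruncation hext (a Q)
  have hchain : IsChain (· ≤ ·) (Set.range νQ) := by
    rintro _ ⟨Q, rfl⟩ _ ⟨R, rfl⟩ -
    exact (le_total (νbar (X - C (a Q))) (νbar (X - C (a R)))).imp
      (centeredTruncation_mono hext) (centeredTruncation_mono hext)
  have hub : ν ∈ upperBounds (Set.range νQ) :=
    Set.forall_mem_range.2 fun _ => centeredTruncation_le hext
  have hattained (f : K[X]) : ∃ μ ∈ Set.range νQ, μ.1 f = ν.1 f := by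
    obtain ⟨Q, hQ, hle⟩ :=
      exists_isKeyFor_delta_le νbar (f.map (algebraMap K (AlgebraicClosure K)))
    exact ⟨_, ⟨⟨Q, hQ⟩, rfl⟩, centeredTruncation_eq hext (hle.trans_eq (hδ ⟨Q, hQ⟩))⟩
  have hstable {f : K[X]} {μ : ExtVal ν₀} := stableFrom_iff (μ := μ) hchain hub (hattained f)
  have hlub : IsLUB (Set.range νQ) ν := isLUB_of_forall_exists_map_eq hub hattained
  exact ⟨_, νQ, fun Q => ⟨Q.2.1, Q.2.2.1, νbar, hext, Q.2.2.2⟩,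
    fun Q => centeredTruncation_eq_truncation hext hKrull Q.2 (ha Q) (hδ Q), hchain,
    fun μ => eq_of_maximal_of_isLUB hchain hlub, fun f => (hattained f).imp fun _ => hstable.2,
    fun f μ hμ => (hstable.1 hμ).2.symm, hlub,
    fun Q => isResidueTranscendental_centeredTruncation hext hν (ha Q) (hδ Q).le⟩

theorem mainTheorem7 {K Γ : Type*} [Field K]
    [AddCommGroup Γ] [LinearOrder Γ] [IsOrderedAddMonoid Γ]
    (hΓ : ∀ n : ℕ, n ≠ 0 → ∀ γ : Γ, ∃ γ' : Γ, n • γ' = γ)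
    (ν₀ : AddValuation K (WithTop Γ)) (ν : ExtVal ν₀) (hν : IsValuationAlgebraic ν) :
    ∃ (QQ : Set K[X]) (νQ : QQ → ExtVal ν₀),
      (∀ Q : QQ, IsKeyPolynomial ν.1 (Q : K[X])) ∧
      (∀ (Q : QQ) (f : K[X]), (νQ Q).1 f = truncation ν.1 (Q : K[X]) f) ∧
      IsChain (· ≤ ·) (Set.range νQ) ∧
      (∀ μ : ExtVal ν₀, ¬ Maximal (· ∈ Set.range νQ) μ) ∧
      (∀ f : K[X], IsStable (Set.range νQ) f) ∧
      IsStableSup (Set.range νQ) ν ∧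
      IsLUB (Set.range νQ) ν ∧
      (∀ Q : QQ, IsResidueTranscendental (νQ Q)) := by
  obtain ⟨QQ, νQ, hkey, htrunc, hchain, hmax, hstable, hsup, hlub, hres⟩ :=
    mainTheorem7_general hΓ ν₀ ν (not_or.1 hν).1
  refine ⟨QQ, νQ, hkey, htrunc, hchain, fun μ hμ => ?_, hstable, hsup, hlub, hres⟩
  obtain ⟨Q, hQ⟩ := hμ.prop
  exact (not_or.1 hν).2 (hmax μ hμ ▸ hQ ▸ hres Q)
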